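/- Consider the complete network on $n$ nodes with a fixed destination node $d$; each of the other $n-1$ nodes sends one unsplittable unit flow to $d$. The scheme $\mathbf{RFS}$ draws, independently for each source $v$, a uniformly random ordering $\delta_{v,1},\dots,\delta_{v,n-2}$ of the nodes other than $v$ and $d$. The flow of $v$ is routed as follows: the node that currently holds it forwards it directly to $d$ if its link to $d$ has not failed; otherwise it forwards it to the first not yet tried node in the sequence $\delta_{v,\cdot}$ to which its link has not failed, and so on from that node with the later entries of the sequence. The load of a link is the number of flows that cross it. The adversary $\mathbf{Ran}$ fails links one after the other in uniformly random order, independently of the installed sequences. There is an absolute constant $c>0$ such that, for every $a>0$, for all sufficiently large $n$ (for all $n$ if $a\le 2$) and for every real $\varphi$ with $82^2\log_2^4 n\le\varphi\le n$, the following holds with probability at least $1-n^{-a}$: in order to create a load of at least $\sqrt{\varphi}$ on some link, $\mathbf{Ran}$ has to fail at least $c\,\varphi$ links. With the same constants, the same holds if $\mathbf{Ran}$ knows the destination and fails only links incident to $d$, in uniformly random order. -/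

import Mathlib

namespace LocalFailover

/-- The links of the full mesh (clique) on the set of nodes `V`. -/
noncomputable def links (V : Type*) [Fintype V] [DecidableEq V] : Finset (Sym2 V) :=
  (⊤ : SimpleGraph V).edgeFinset

/-- The links of the full mesh that are incident to the node `d`. -/
noncomputable def linksAt {V : Type*} [Fintype V] [DecidableEq V] (d : V) : Finset (Sym2 V) :=
  (links V).filter fun e => d ∈ e

/-- A failover matrix for the destination `d`: for every source `v ≠ d`, a row that lists all
nodes other than `v` and `d` in some order, each of them exactly once. -/
abbrev FailoverMatrix {V : Type*} [Fintype V] (d : V) : Type _ :=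
  (v : {v : V // v ≠ d}) → (Fin (Fintype.card V - 2) ≃ {x : V // x ≠ v.1 ∧ x ≠ d})

/-- The links crossed, from the node `u` on, by a flow with destination `d` whose remaining backup
nodes are listed in the third explicit argument, when the links in `F` have failed: `u` forwards
directly to `d` if the link is available; otherwise it forwards to the first remaining backup node
to which its link is available, where the procedure continues with the backup nodes listed after
that one. A flow that runs out of backup nodes is dropped. -/
def crossed {V : Type*} [DecidableEq V] (F : Finset (Sym2 V)) (d : V) : V → List V → List (Sym2 V)
  | u, [] => if s(u, d) ∈ F then [] else [s(u, d)]
  | u, x :: l =>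
      if s(u, d) ∈ F then
        if s(u, x) ∈ F then crossed F d u l else s(u, x) :: crossed F d x l
      else [s(u, d)]

/-- The links crossed by the flow from the source `v` to `d`. -/
def flow {V : Type*} [Fintype V] [DecidableEq V] {d : V} (δ : FailoverMatrix d)
    (F : Finset (Sym2 V)) (v : {v : V // v ≠ d}) : List (Sym2 V) :=
  crossed F d v.1 (List.ofFn fun j => (δ v j).1)

/-- The load of the link `e`: the number of flows crossing it, when every node other than `d` is
the source of one flow to `d`. -/
def load {V : Type*} [Fintype V] [DecidableEq V] {d : V} (δ : FailoverMatrix d)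
    (F : Finset (Sym2 V)) (e : Sym2 V) : ℕ :=
  (Finset.univ.filter fun v : {v : V // v ≠ d} => e ∈ flow δ F v).card

/-- The maximum link load. -/
noncomputable def maxLoad {V : Type*} [Fintype V] [DecidableEq V] {d : V} (δ : FailoverMatrix d)
    (F : Finset (Sym2 V)) : ℕ :=
  (links V).sup (load δ F)

/-- An order in which the links in `E` fail, one after the other. -/
abbrev FailureOrder {V : Type*} (E : Finset (Sym2 V)) : Type _ :=
  Fin E.card ≃ {e : Sym2 V // e ∈ E}

/-- The set of the first `k` links that fail (all of `E` if `k` is larger than its size). -/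
def failed {V : Type*} [DecidableEq V] {E : Finset (Sym2 V)} (σ : FailureOrder E) (k : ℕ) :
    Finset (Sym2 V) :=
  (Finset.univ.filter fun i : Fin E.card => (i : ℕ) < k).image fun i => (σ i).1

/-- The probability of the event `A` under the uniform distribution on a finite sample space. -/
noncomputable def unifProb {Ω : Type*} [Finite Ω] (A : Set Ω) : ℝ :=
  (A.ncard : ℝ) / (Nat.card Ω : ℝ)

/-- The probability that at least `m` links have to fail before the maximum load reaches `L`, for
uniformly random, mutually independent rows of the failover matrix, and, independently of them, an
adversary who fails the links in `E` one after the other in uniformly random order. -/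
noncomputable def probNeeds {V : Type*} [Fintype V] [DecidableEq V] (d : V)
    (E : Finset (Sym2 V)) (L m : ℝ) : ℝ :=
  unifProb {ω : FailoverMatrix d × FailureOrder E |
    ∀ k : ℕ, L ≤ (maxLoad ω.1 (failed ω.2 k) : ℝ) → m ≤ (k : ℝ)}

end LocalFailover

namespace LocalFailover

/-! Fix a set `F` of at most `n / 16` failed links and a link `e`. Some endpoint `u ≠ d` of `e`
exists, and a flow crosses `e` only if it crosses a link at `u`. Let `p s` bound the probability of
this for a flow held at a node other than `u` with `s` random backup nodes left. Exposing the next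
entry `x`, the flow can still reach `u` only if `x = u`, or the link from the holder to `x` failed,
or the link from `x` to `d` failed; the last two cases cover at most `|F|` nodes each. Hence `p (s +
1) ≤ (1 + 2 |F| p s) / (s + 1)`, which yields `card_crossed_le` and a probability of at most `6 / n`
per source.

The rows are independent, so the mean of `2 ^ load` is at most `2 (1 + 6 / n) ^ n ≤ 2 exp 6`
(`sum_two_pow_load_le`), and Markov's inequality gives an exponential tail. A union bound over links
and failure counts finishes (`one_sub_le_probNeeds`). The bound holds for every small `F`, so only
the independence of the failures from the rows matters, and one argument serves both adversaries. -/

/-- The lists that enumerate the finite set `S` without repetition. -/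
def orderings {V : Type*} (S : Finset V) : Finset (List V) :=
  ⟨Multiset.lists S.val, Multiset.lists_nodup_finset S⟩

theorem mem_orderings {V : Type*} {S : Finset V} {l : List V} :
    l ∈ orderings S ↔ S.val = (l : Multiset V) := by
  rw [orderings, Finset.mem_mk]
  exact Multiset.mem_lists_iff S.val l

theorem card_orderings {V : Type*} (S : Finset V) : (orderings S).card = S.card.factorial := by
  have h : Multiset.lists S.val = (S.toList.permutations : Multiset (List V)) := by
    rw [← Multiset.lists_coe, Finset.coe_toList]
  rw [orderings, Finset.card_mk, h, Multiset.coe_card, List.length_permutations,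
    Finset.length_toList]

/-- Orderings of a nonempty set are counted according to their first entry. -/
theorem card_filter_orderings_le {V : Type*} [DecidableEq V] {S : Finset V} (hS : S.Nonempty)
    (P : List V → Prop) [DecidablePred P] :
    ((orderings S).filter P).card ≤
      ∑ x ∈ S, ((orderings (S.erase x)).filter fun l => P (x :: l)).card := by
  have hsub : (orderings S).filter P ⊆ S.biUnion fun x =>
      ((orderings (S.erase x)).filter fun l => P (x :: l)).image (List.cons x) := by
    intro l hl
    obtain ⟨hl, hP⟩ := Finset.mem_filter.1 hl
    rw [mem_orderings] at hl
    cases l with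
    | nil =>
      rw [Multiset.coe_nil, Finset.val_eq_zero] at hl
      exact absurd hl hS.ne_empty
    | cons x l =>
      have hx : x ∈ S := by
        rw [← Finset.mem_val, hl]
        simp
      refine Finset.mem_biUnion.2 ⟨x, hx, Finset.mem_image.2 ⟨l, ?_, rfl⟩⟩
      refine Finset.mem_filter.2 ⟨?_, hP⟩
      rw [mem_orderings, Finset.erase_val, hl, Multiset.coe_erase, List.erase_cons_head]
  calc _ ≤ _ := Finset.card_le_card hsub
    _ ≤ _ := Finset.card_biUnion_le
    _ ≤ _ := Finset.sum_le_sum fun x _ => Finset.card_image_le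

/-! ### A single flow with randomly ordered backup nodes -/

/-- The first step of a flow that later crosses a link at `u`. -/
theorem exists_mem_crossed_cons {V : Type*} [DecidableEq V] {F : Finset (Sym2 V)} {d u h x : V}
    {l : List V} (hu : u ≠ d) (hh : h ≠ u) (hx : x ≠ u)
    (H : ∃ e ∈ crossed F d h (x :: l), u ∈ e) :
    (s(h, x) ∈ F ∧ ∃ e ∈ crossed F d h l, u ∈ e) ∨
      (s(x, d) ∈ F ∧ ∃ e ∈ crossed F d x l, u ∈ e) := by
  have hdir : ∀ y : V, y ≠ u → u ∉ s(y, d) := fun y hy => by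
    rw [Sym2.mem_iff]
    exact fun h => h.elim (fun h => hy h.symm) hu
  obtain ⟨e, he, hue⟩ := H
  rw [crossed] at he
  split_ifs at he with h1 h2
  · exact Or.inl ⟨h2, e, he, hue⟩
  · rcases List.mem_cons.1 he with rfl | he
    · rcases Sym2.mem_iff.1 hue with h | h
      · exact absurd h.symm hh
      · exact absurd h.symm hx
    · refine Or.inr ⟨?_, e, he, hue⟩
      -- If `x` can reach `d` directly, the rest of the path is the single link from `x` to `d`,
      -- which avoids `u`.
      by_contra hxd
      have : e = s(x, d) := by
        cases l <;> simpa [crossed, hxd] using he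
      exact hdir x hx (this ▸ hue)
  · rw [List.mem_singleton] at he
    exact absurd (he ▸ hue) (hdir h hh)

theorem not_exists_mem_crossed_nil {V : Type*} [DecidableEq V] {F : Finset (Sym2 V)} {d u h : V}
    (hu : u ≠ d) (hh : h ≠ u) : ¬ ∃ e ∈ crossed F d h [], u ∈ e := by
  rintro ⟨e, he, hue⟩
  rw [crossed] at he
  split_ifs at he
  · simp at he
  · rw [List.mem_singleton] at he
    subst he
    exact (Sym2.mem_iff.1 hue).elim (fun h => hh h.symm) hu

/-- The proportion of the orderings of `S` that lead a flow from `h` over a link at `u`. -/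
theorem card_crossed_le {V : Type*} [DecidableEq V] (F : Finset (Sym2 V)) {d u : V} (hu : u ≠ d)
    (s : ℕ) (S : Finset V) (hS : S.card = s) (h : V) (hh : h ≠ u) :
    (((orderings S).filter fun l => ∃ e ∈ crossed F d h l, u ∈ e).card : ℝ) ≤
      s.factorial * (2 / s + 2 ^ (4 * F.card) / 2 ^ s) := by
  induction s generalizing S h with
  | zero =>
    have hS0 : S = ∅ := Finset.card_eq_zero.1 hS
    have : ((orderings S).filter fun l => ∃ e ∈ crossed F d h l, u ∈ e) = ∅ := by
      refine Finset.filter_eq_empty_iff.2 fun l hl => ?_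
      rw [mem_orderings, hS0, Finset.empty_val, eq_comm, Multiset.coe_eq_zero] at hl
      rw [hl]
      exact not_exists_mem_crossed_nil hu hh
    rw [this]
    simp
  | succ s ih =>
    set B : ℝ := s.factorial * (2 / s + 2 ^ (4 * F.card) / 2 ^ s) with hB
    have hB0 : 0 ≤ B := by positivity
    -- Here the exponential term alone is at least 1, so the bound is trivial; it serves to start
    -- the recursion.
    by_cases hs : s + 1 ≤ 4 * F.card
    · have h1 : ((orderings S).filter fun l => ∃ e ∈ crossed F d h l, u ∈ e).card ≤
          (s + 1).factorial := by
        rw [← hS, ← card_orderings]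
        exact Finset.card_filter_le _ _
      have h2 : (1 : ℝ) ≤ 2 ^ (4 * F.card) / 2 ^ (s + 1) := by
        rw [one_le_div (by positivity)]
        exact pow_le_pow_right₀ one_le_two hs
      have h3 : (0 : ℝ) ≤ 2 / ((s + 1 : ℕ) : ℝ) := by positivity
      calc _ ≤ (((s + 1).factorial : ℕ) : ℝ) := by exact_mod_cast h1
        _ = ((s + 1).factorial : ℝ) * 1 := (mul_one _).symm
        _ ≤ _ := by gcongr; linarith
    · have hne : S.Nonempty := Finset.card_pos.1 (by omega)
      have hterm : ∀ x ∈ S, (((orderings (S.erase x)).filter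
          fun l => ∃ e ∈ crossed F d h (x :: l), u ∈ e).card : ℝ) ≤
            (if x = u then (s.factorial : ℝ) else 0) +
              ((if s(h, x) ∈ F then B else 0) + if s(x, d) ∈ F then B else 0) := by
        intro x hx
        have hcard : (S.erase x).card = s := by rw [Finset.card_erase_of_mem hx, hS]; rfl
        by_cases hxu : x = u
        · rw [if_pos hxu]
          have h1 : (0 : ℝ) ≤ if s(h, x) ∈ F then B else 0 := by split_ifs <;> positivity
          have h2 : (0 : ℝ) ≤ if s(x, d) ∈ F then B else 0 := by split_ifs <;> positivity
          have h3 : ((orderings (S.erase x)).filter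
              fun l => ∃ e ∈ crossed F d h (x :: l), u ∈ e).card ≤ s.factorial := by
            rw [← hcard, ← card_orderings]
            exact Finset.card_filter_le _ _
          have h4 : (((orderings (S.erase x)).filter
              fun l => ∃ e ∈ crossed F d h (x :: l), u ∈ e).card : ℝ) ≤ s.factorial := by
            exact_mod_cast h3
          linarith
        · rw [if_neg hxu, zero_add]
          have hsub : ((orderings (S.erase x)).filter
              fun l => ∃ e ∈ crossed F d h (x :: l), u ∈ e) ⊆
              ((orderings (S.erase x)).filter
                fun l => s(h, x) ∈ F ∧ ∃ e ∈ crossed F d h l, u ∈ e) ∪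
              ((orderings (S.erase x)).filter
                fun l => s(x, d) ∈ F ∧ ∃ e ∈ crossed F d x l, u ∈ e) := by
            rw [← Finset.filter_or]
            exact Finset.monotone_filter_right _
              fun l _ hl => exists_mem_crossed_cons hu hh hxu hl
          have hbound : ∀ (p : Prop) [Decidable p] (y : V), y ≠ u →
              (((orderings (S.erase x)).filter
                fun l => p ∧ ∃ e ∈ crossed F d y l, u ∈ e).card : ℝ) ≤ if p then B else 0 := by
            intro p _ y hy
            split_ifs with hp
            · simpa only [hp, true_and] using ih _ hcard y hy
            · simp [hp]
          refine le_trans ?_ (add_le_add (hbound _ h hh) (hbound _ x hxu))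
          exact_mod_cast (Finset.card_le_card hsub).trans (Finset.card_union_le _ _)
      have hF : ∀ f : V → Sym2 V, Function.Injective f →
          ∑ x ∈ S, (if f x ∈ F then B else 0) ≤ F.card * B := by
        intro f hf
        rw [← Finset.sum_filter, Finset.sum_const, nsmul_eq_mul]
        refine mul_le_mul_of_nonneg_right ?_ hB0
        exact_mod_cast Finset.card_le_card_of_injOn f
          (fun x hx => (Finset.mem_filter.1 hx).2) hf.injOn
      have h1 := hF (fun x => s(h, x)) fun x y hxy => Sym2.congr_right.1 hxy
      have h2 := hF (fun x => s(x, d)) fun x y hxy => Sym2.congr_left.1 hxy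
      have h3 : ∑ x ∈ S, (if x = u then (s.factorial : ℝ) else 0) ≤ s.factorial := by
        rw [Finset.sum_ite_eq']
        split_ifs
        · exact le_rfl
        · positivity
      have h4 : (((orderings S).filter fun l => ∃ e ∈ crossed F d h l, u ∈ e).card : ℝ) ≤
          s.factorial + 2 * F.card * B := by
        have h5 := (Nat.cast_le (α := ℝ)).2
          (card_filter_orderings_le hne fun l => ∃ e ∈ crossed F d h l, u ∈ e)
        rw [Nat.cast_sum] at h5
        have h6 := h5.trans (Finset.sum_le_sum hterm)
        rw [Finset.sum_add_distrib, Finset.sum_add_distrib] at h6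
        linarith
      refine h4.trans ?_
      have hFs : 4 * (F.card : ℝ) ≤ s := by
        have : 4 * F.card ≤ s := by omega
        exact_mod_cast this
      -- Since `4 |F| ≤ s`, the term `2 / s` reproduces itself under the recursion and the
      -- exponential term at least halves. For `s = 0` the convention `2 / 0 = 0` is harmless.
      have h7 : 2 * (F.card : ℝ) * (2 / s) ≤ 1 := by
        rw [mul_div_assoc']
        exact div_le_one_of_le₀ (by linarith) (by positivity)
      set q : ℝ := 2 ^ (4 * F.card) / 2 ^ s with hq
      have hq0 : 0 ≤ q := by positivity
      have hq' : (2 : ℝ) ^ (4 * F.card) / 2 ^ (s + 1) = q / 2 := by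
        rw [hq, pow_succ, div_div]
      have h8 : 2 * (F.card : ℝ) * q ≤ (s + 1) * (q / 2) := by nlinarith
      rw [hq', hB, Nat.factorial_succ]
      push_cast
      have h9 : ((s : ℝ) + 1) * (2 / (s + 1)) = 2 := by field_simp
      have hfac : (0 : ℝ) ≤ s.factorial := by positivity
      calc (s.factorial : ℝ) + 2 * F.card * (s.factorial * (2 / s + q))
          = s.factorial * (1 + 2 * F.card * (2 / s) + 2 * F.card * q) := by ring
        _ ≤ s.factorial * ((s + 1) * (2 / (s + 1)) + (s + 1) * (q / 2)) := by
            rw [h9]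
            gcongr
            linarith
        _ = _ := by ring

/-! ### From orderings to rows of the failover matrix -/

theorem card_filter_ne_ne {V : Type*} [Fintype V] [DecidableEq V] {v d : V} (hv : v ≠ d) :
    (Finset.univ.filter fun x : V => x ≠ v ∧ x ≠ d).card = Fintype.card V - 2 := by
  have : (Finset.univ.filter fun x : V => x ≠ v ∧ x ≠ d) = ({v, d} : Finset V)ᶜ := by
    ext x
    simp
  rw [this, Finset.card_compl, Finset.card_pair hv]

theorem card_row {V : Type*} [Fintype V] [DecidableEq V] {v d : V} (hv : v ≠ d) :
    Fintype.card (Fin (Fintype.card V - 2) ≃ {x : V // x ≠ v ∧ x ≠ d}) =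
      (Fintype.card V - 2).factorial := by
  have h : Fintype.card {x : V // x ≠ v ∧ x ≠ d} = Fintype.card V - 2 := by
    rw [Fintype.card_subtype, card_filter_ne_ne hv]
  rw [Fintype.card_equiv (Fintype.equivFinOfCardEq h).symm, Fintype.card_fin]

theorem ofFn_row_mem_orderings {V : Type*} [Fintype V] [DecidableEq V] {v d : V}
    (r : Fin (Fintype.card V - 2) ≃ {x : V // x ≠ v ∧ x ≠ d}) :
    List.ofFn (fun j => (r j).1) ∈ orderings (Finset.univ.filter fun x : V => x ≠ v ∧ x ≠ d) := by
  have hnd : (List.ofFn fun j => (r j).1).Nodup :=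
    List.nodup_ofFn.2 (Subtype.val_injective.comp r.injective)
  rw [mem_orderings]
  refine Multiset.Nodup.ext (Finset.nodup _) (Multiset.coe_nodup.2 hnd) |>.2 fun x => ?_
  rw [Finset.mem_val, Finset.mem_filter, Multiset.mem_coe, List.mem_ofFn]
  constructor
  · intro h
    exact ⟨r.symm ⟨x, h.2⟩, by simp⟩
  · rintro ⟨j, rfl⟩
    exact ⟨Finset.mem_univ _, (r j).2⟩

/-- The number of rows that lead the flow from `v` over a link at `u`. -/
theorem card_row_crossed_le {V : Type*} [Fintype V] [DecidableEq V] (F : Finset (Sym2 V))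
    {v d u : V} (hu : u ≠ d) (hv : v ≠ d) (hvu : v ≠ u) :
    ((Finset.univ.filter fun r : Fin (Fintype.card V - 2) ≃ {x : V // x ≠ v ∧ x ≠ d} =>
      ∃ e ∈ crossed F d v (List.ofFn fun j => (r j).1), u ∈ e).card : ℝ) ≤
      (Fintype.card V - 2).factorial *
        (2 / (Fintype.card V - 2 : ℕ) + 2 ^ (4 * F.card) / 2 ^ (Fintype.card V - 2)) := by
  refine le_trans ?_ (card_crossed_le F hu _ _ (card_filter_ne_ne hv) v hvu)
  refine Nat.cast_le.2 (Finset.card_le_card_of_injOn (fun r => List.ofFn fun j => (r j).1)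
    (fun r hr => ?_) fun r _ r' _ h => ?_)
  · exact Finset.mem_filter.2 ⟨ofFn_row_mem_orderings r, (Finset.mem_filter.1 hr).2⟩
  · ext j
    exact congrFun (List.ofFn_injective h) j

/-- With `16 k ≤ n` the exponent `n - 2 - 4 k` is linear in `n`, so the second term is also `O(1 /
n)`. -/
theorem two_div_add_le {n k : ℕ} (hn : 8 ≤ n) (hk : 16 * k ≤ n) :
    (2 : ℝ) / (n - 2 : ℕ) + 2 ^ (4 * k) / 2 ^ (n - 2) ≤ 6 / n := by
  obtain ⟨m, hm⟩ : ∃ m, n - 2 = 4 * k + m := Nat.exists_eq_add_of_le (by omega)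
  have hn0 : (0 : ℝ) < n := by exact_mod_cast (by omega : 0 < n)
  have hs0 : (0 : ℝ) < (n - 2 : ℕ) := by exact_mod_cast (by omega : 0 < n - 2)
  have h1 : (2 : ℝ) / (n - 2 : ℕ) ≤ 4 / n := by
    rw [div_le_div_iff₀ hs0 hn0]
    exact_mod_cast (by omega : 2 * n ≤ 4 * (n - 2))
  have h2 : (2 : ℝ) ^ (4 * k) / 2 ^ (n - 2) ≤ 2 / n := by
    rw [hm, pow_add, div_mul_eq_div_div, div_self (by positivity),
      div_le_div_iff₀ (by positivity) hn0]
    have : m < 2 ^ m := Nat.lt_two_pow_self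
    exact_mod_cast (by omega : 1 * n ≤ 2 * 2 ^ m)
  calc _ ≤ (4 : ℝ) / n + 2 / n := add_le_add h1 h2
    _ = _ := by ring

/-! ### Exponential moment and tail of the load -/

/-- The exponential moment of the load under the uniform distribution of the failover matrix. -/
theorem sum_two_pow_load_le {V : Type*} [Fintype V] [DecidableEq V] {d : V}
    (hV : 8 ≤ Fintype.card V) (F : Finset (Sym2 V)) (hF : 16 * F.card ≤ Fintype.card V)
    {e : Sym2 V} (he : e ∈ links V) :
    ∑ δ : FailoverMatrix d, (2 : ℝ) ^ load δ F e ≤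
      2 * Real.exp 6 * Fintype.card (FailoverMatrix d) := by
  obtain ⟨u, hue, hud⟩ : ∃ u ∈ e, u ≠ d := by
    induction e with
    | h x y =>
      have hxy : x ≠ y := by simpa [links] using he
      by_cases hx : x = d
      · exact ⟨y, Sym2.mem_mk_right x y, fun hy => hxy (hx.trans hy.symm)⟩
      · exact ⟨x, Sym2.mem_mk_left x y, hx⟩
  have hn0 : (0 : ℝ) < Fintype.card V := by exact_mod_cast (by omega : 0 < Fintype.card V)
  have hprod : ∀ δ : FailoverMatrix d, (2 : ℝ) ^ load δ F e =
      ∏ v : {v : V // v ≠ d}, if e ∈ crossed F d v.1 (List.ofFn fun j => (δ v j).1)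
        then (2 : ℝ) else 1 := by
    intro δ
    rw [← Finset.prod_filter, Finset.prod_const]
    rfl
  have hrow : ∀ v : {v : V // v ≠ d},
      ∑ r : Fin (Fintype.card V - 2) ≃ {x : V // x ≠ v.1 ∧ x ≠ d},
        (if e ∈ crossed F d v.1 (List.ofFn fun j => (r j).1) then (2 : ℝ) else 1) ≤
      Fintype.card (Fin (Fintype.card V - 2) ≃ {x : V // x ≠ v.1 ∧ x ≠ d}) *
        ((if v.1 = u then 2 else 1) * (1 + 6 / Fintype.card V)) := by
    intro v
    have hq : (0 : ℝ) ≤ 6 / Fintype.card V := by positivity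
    -- The flow that starts at `u` always touches `u`; it costs only one factor 2 in the product.
    split_ifs with hvu
    · calc _ ≤ ∑ r : Fin (Fintype.card V - 2) ≃ {x : V // x ≠ v.1 ∧ x ≠ d}, (2 : ℝ) :=
            Finset.sum_le_sum fun r _ => by split_ifs <;> norm_num
        _ = Fintype.card (Fin (Fintype.card V - 2) ≃ {x : V // x ≠ v.1 ∧ x ≠ d}) * 2 := by
            rw [Finset.sum_const, nsmul_eq_mul, Finset.card_univ]
        _ ≤ _ := by
            gcongr
            linarith
    · have hsum : ∑ r : Fin (Fintype.card V - 2) ≃ {x : V // x ≠ v.1 ∧ x ≠ d},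
          (if e ∈ crossed F d v.1 (List.ofFn fun j => (r j).1) then (2 : ℝ) else 1) ≤
          ∑ r : Fin (Fintype.card V - 2) ≃ {x : V // x ≠ v.1 ∧ x ≠ d},
          (1 + if ∃ e ∈ crossed F d v.1 (List.ofFn fun j => (r j).1), u ∈ e
            then (1 : ℝ) else 0) := by
        refine Finset.sum_le_sum fun r _ => ?_
        by_cases h : e ∈ crossed F d v.1 (List.ofFn fun j => (r j).1)
        · rw [if_pos h, if_pos ⟨e, h, hue⟩]
          norm_num
        · rw [if_neg h]
          split_ifs <;> norm_num
      refine hsum.trans ?_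
      rw [Finset.sum_add_distrib, Finset.sum_const, Finset.card_univ, Finset.sum_boole,
        nsmul_eq_mul, one_mul, mul_add]
      refine add_le_add le_rfl ((card_row_crossed_le F hud v.2 hvu).trans ?_)
      rw [card_row v.2]
      exact mul_le_mul_of_nonneg_left (two_div_add_le hV hF) (Nat.cast_nonneg _)
  have hexp : ∏ v : {v : V // v ≠ d}, ((if v.1 = u then (2 : ℝ) else 1) *
      (1 + 6 / Fintype.card V)) ≤ 2 * Real.exp 6 := by
    rw [Finset.prod_mul_distrib]
    have h1 : ∏ v : {v : V // v ≠ d}, (if v.1 = u then (2 : ℝ) else 1) = 2 := by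
      rw [Finset.prod_eq_single ⟨u, hud⟩ (fun v _ hv => if_neg fun h => hv (Subtype.ext h))
        (fun h => absurd (Finset.mem_univ _) h), if_pos rfl]
    rw [h1, Finset.prod_const, Finset.card_univ]
    have hcard : Fintype.card {v : V // v ≠ d} ≤ Fintype.card V := Fintype.card_subtype_le _
    have h2 : (1 : ℝ) + 6 / Fintype.card V ≤ Real.exp (6 / Fintype.card V) := by
      rw [add_comm]
      exact Real.add_one_le_exp _
    have h3 : (1 : ℝ) ≤ 1 + 6 / Fintype.card V := by
      have : (0 : ℝ) ≤ 6 / Fintype.card V := by positivity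
      linarith
    refine mul_le_mul_of_nonneg_left ?_ zero_le_two
    calc _ ≤ ((1 : ℝ) + 6 / Fintype.card V) ^ Fintype.card V := pow_le_pow_right₀ h3 hcard
      _ ≤ Real.exp (6 / Fintype.card V) ^ Fintype.card V := by gcongr
      _ = Real.exp 6 := by
          rw [← Real.exp_nat_mul]
          congr 1
          field_simp
  calc ∑ δ : FailoverMatrix d, (2 : ℝ) ^ load δ F e
      = ∏ v : {v : V // v ≠ d}, ∑ r : Fin (Fintype.card V - 2) ≃ {x : V // x ≠ v.1 ∧ x ≠ d},
          (if e ∈ crossed F d v.1 (List.ofFn fun j => (r j).1) then (2 : ℝ) else 1) := by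
        -- Independence of the rows: the sum over matrices factors into sums over rows.
        rw [Finset.prod_univ_sum, Fintype.piFinset_univ]
        exact Finset.sum_congr rfl fun δ _ => hprod δ
    _ ≤ ∏ v : {v : V // v ≠ d},
          ((Fintype.card (Fin (Fintype.card V - 2) ≃ {x : V // x ≠ v.1 ∧ x ≠ d}) : ℝ) *
            ((if v.1 = u then 2 else 1) * (1 + 6 / Fintype.card V))) :=
        Finset.prod_le_prod (fun v _ => Finset.sum_nonneg fun r _ => by split_ifs <;> norm_num)
          fun v _ => hrow v
    _ ≤ _ := by
        rw [Finset.prod_mul_distrib, Fintype.card_pi, Nat.cast_prod, mul_comm]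
        exact mul_le_mul_of_nonneg_right hexp (Finset.prod_nonneg fun v _ => Nat.cast_nonneg _)

/-- The number of failover matrices that put a load of at least `L` on the link `e`. -/
theorem card_le_load_le {V : Type*} [Fintype V] [DecidableEq V] {d : V}
    (hV : 8 ≤ Fintype.card V) (F : Finset (Sym2 V)) (hF : 16 * F.card ≤ Fintype.card V)
    {e : Sym2 V} (he : e ∈ links V) (L : ℝ) :
    ((Finset.univ.filter fun δ : FailoverMatrix d => L ≤ load δ F e).card : ℝ) ≤
      2 * Real.exp 6 / (2 : ℝ) ^ L * Fintype.card (FailoverMatrix d) := by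
  have h2 : (0 : ℝ) < (2 : ℝ) ^ L := by positivity
  rw [div_mul_eq_mul_div, le_div_iff₀ h2]
  refine le_trans ?_ (sum_two_pow_load_le hV F hF he)
  rw [← nsmul_eq_mul, ← Finset.sum_const, Finset.sum_filter]
  refine Finset.sum_le_sum fun δ _ => ?_
  split_ifs with h
  · rw [← Real.rpow_natCast]
    exact Real.rpow_le_rpow_of_exponent_le one_le_two h
  · positivity

/-! ### Union bound over failure counts and links -/

theorem card_failed_le {V : Type*} [DecidableEq V] {E : Finset (Sym2 V)} (σ : FailureOrder E)
    (k : ℕ) : (failed σ k).card ≤ k := by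
  refine Finset.card_image_le.trans ?_
  rw [Fin.card_filter_val_lt]
  exact min_le_right _ _

theorem exists_le_load_of_le_maxLoad {V : Type*} [Fintype V] [DecidableEq V] {d : V}
    {δ : FailoverMatrix d} {F : Finset (Sym2 V)} {L : ℝ} (hL : 0 < L)
    (h : L ≤ (maxLoad δ F : ℝ)) : ∃ e ∈ links V, L ≤ (load δ F e : ℝ) := by
  have h1 : ⌈L⌉₊ ≤ (links V).sup (load δ F) := Nat.ceil_le.2 h
  rw [Finset.le_sup_iff (Nat.ceil_pos.2 hL)] at h1
  obtain ⟨e, he, h2⟩ := h1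
  exact ⟨e, he, Nat.ceil_le.1 h2⟩

/-- Whatever links `E` the adversary fails in random order, a load of at least `L` needs at least
`m` failures with high probability, as long as `16 * m ≤ n`. -/
theorem one_sub_le_probNeeds {V : Type*} [Fintype V] [DecidableEq V] (d : V)
    (hV : 8 ≤ Fintype.card V) (E : Finset (Sym2 V)) {L m : ℝ} (hL : 0 < L)
    (hm : 16 * m ≤ Fintype.card V) :
    1 - (Fintype.card V : ℝ) ^ 3 * (2 * Real.exp 6 / (2 : ℝ) ^ L) ≤ probNeeds d E L m := by
  set n := Fintype.card V with hn
  set C : ℝ := 2 * Real.exp 6 / (2 : ℝ) ^ L with hC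
  set A : Set (FailoverMatrix d × FailureOrder E) := {ω |
    ∀ k : ℕ, L ≤ (maxLoad ω.1 (failed ω.2 k) : ℝ) → m ≤ (k : ℝ)} with hA
  have hlinks : (links V).card ≤ n ^ 2 := by
    rw [links, SimpleGraph.card_edgeFinset_top_eq_card_choose_two]
    exact Nat.choose_le_pow n 2
  set T := ((Finset.range n).filter fun k => 16 * k ≤ n) ×ˢ links V with hT
  have hTcard : T.card ≤ n ^ 3 := by
    rw [hT, Finset.card_product, pow_succ, mul_comm]
    refine Nat.mul_le_mul hlinks ?_
    exact (Finset.card_filter_le _ _).trans (Finset.card_range n).le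
  have hsub : Aᶜ ⊆ ((T.biUnion fun t => Finset.univ.filter
      fun ω : FailoverMatrix d × FailureOrder E => L ≤ load ω.1 (failed ω.2 t.1) t.2 :
        Finset (FailoverMatrix d × FailureOrder E)) : Set _) := by
    intro ω hω
    simp only [hA, Set.mem_compl_iff, Set.mem_ofPred_eq, not_forall, not_le] at hω
    obtain ⟨k, hk, hkm⟩ := hω
    obtain ⟨e, he, hle⟩ := exists_le_load_of_le_maxLoad hL hk
    have hk16 : 16 * k < n := by
      have : (16 : ℝ) * k < n := by linarith
      exact_mod_cast this
    rw [Finset.mem_coe, Finset.mem_biUnion]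
    refine ⟨(k, e), ?_, Finset.mem_filter.2 ⟨Finset.mem_univ _, hle⟩⟩
    rw [hT, Finset.mem_product, Finset.mem_filter, Finset.mem_range]
    exact ⟨⟨by omega, hk16.le⟩, he⟩
  have hone : ∀ t ∈ T, ((Finset.univ.filter fun ω : FailoverMatrix d × FailureOrder E =>
      L ≤ load ω.1 (failed ω.2 t.1) t.2).card : ℝ) ≤
        C * Fintype.card (FailoverMatrix d × FailureOrder E) := by
    rintro ⟨k, e⟩ ht
    rw [hT, Finset.mem_product, Finset.mem_filter] at ht
    -- Conditioning on the failure order makes the failed set fixed, of size at most `k ≤ n / 16`.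
    rw [Finset.card_filter, Nat.cast_sum, Fintype.sum_prod_type_right, Fintype.card_prod]
    calc _ ≤ ∑ σ : FailureOrder E, C * Fintype.card (FailoverMatrix d) := by
          refine Finset.sum_le_sum fun σ _ => ?_
          have h16 : 16 * (failed σ k).card ≤ n :=
            (Nat.mul_le_mul_left 16 (card_failed_le σ k)).trans ht.1.2
          rw [← Nat.cast_sum, ← Finset.card_filter]
          exact card_le_load_le hV _ h16 ht.2 L
      _ = _ := by
          rw [Finset.sum_const, Finset.card_univ, nsmul_eq_mul, Nat.cast_mul]
          ring
  have hcompl : (Aᶜ.ncard : ℝ) ≤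
      n ^ 3 * C * Fintype.card (FailoverMatrix d × FailureOrder E) := by
    have h1 := Set.ncard_le_ncard hsub (Finset.finite_toSet _)
    rw [Set.ncard_coe_finset] at h1
    have h2 := (Nat.cast_le (α := ℝ)).2 (h1.trans Finset.card_biUnion_le)
    rw [Nat.cast_sum] at h2
    refine (h2.trans (Finset.sum_le_sum hone)).trans ?_
    rw [Finset.sum_const, nsmul_eq_mul, ← mul_assoc]
    have hC0 : 0 ≤ C := by positivity
    gcongr
    exact_mod_cast hTcard
  have hpos : (0 : ℝ) < Fintype.card (FailoverMatrix d × FailureOrder E) := by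
    have h1 : 0 < Fintype.card (FailoverMatrix d) := by
      rw [Fintype.card_pi]
      refine Finset.prod_pos fun v _ => ?_
      rw [card_row v.2]
      exact Nat.factorial_pos _
    have h2 : 0 < Fintype.card (FailureOrder E) :=
      Fintype.card_pos_iff.2 ⟨E.equivFin.symm⟩
    rw [Fintype.card_prod]
    exact_mod_cast Nat.mul_pos h1 h2
  have hadd := Set.ncard_add_ncard_compl A
  rw [Nat.card_eq_fintype_card] at hadd
  have hadd' : (A.ncard : ℝ) + Aᶜ.ncard = Fintype.card (FailoverMatrix d × FailureOrder E) := by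
    exact_mod_cast hadd
  rw [probNeeds, unifProb, ← hA, Nat.card_eq_fintype_card, le_div_iff₀ hpos]
  linarith

end LocalFailover

/-! ### Choice of the constants -/

theorem theorem6 :
    ∃ c : ℝ, 0 < c ∧ ∀ a : ℝ, 0 < a → ∃ N : ℕ, (a ≤ 2 → N = 0) ∧
      ∀ n : ℕ, N ≤ n → ∀ d : Fin n, ∀ φ : ℝ,
        82 ^ 2 * Real.logb 2 (n : ℝ) ^ 4 ≤ φ → φ ≤ (n : ℝ) →
          1 - 1 / (n : ℝ) ^ a ≤
              LocalFailover.probNeeds d (LocalFailover.links (Fin n)) (Real.sqrt φ) (c * φ) ∧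
            1 - 1 / (n : ℝ) ^ a ≤
              LocalFailover.probNeeds d (LocalFailover.linksAt d) (Real.sqrt φ) (c * φ) := by
  refine ⟨1 / 16, by norm_num, fun a ha => ?_⟩
  refine ⟨if a ≤ 2 then 0 else ⌈(2 : ℝ) ^ a⌉₊, fun h => if_pos h, ?_⟩
  intro n hN d φ hφ hφn
  suffices H : ∀ E : Finset (Sym2 (Fin n)), 1 - 1 / (n : ℝ) ^ a ≤
      LocalFailover.probNeeds d E (Real.sqrt φ) (1 / 16 * φ) from ⟨H _, H _⟩
  intro E
  have hn0 : 0 < n := d.pos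
  -- For `n = 1` the claimed probability is 0.
  rcases (show n = 1 ∨ 2 ≤ n by omega) with rfl | hn2
  · rw [Nat.cast_one, Real.one_rpow, div_one, sub_self]
    exact div_nonneg (Nat.cast_nonneg _) (Nat.cast_nonneg _)
  have hnR : (0 : ℝ) < n := by exact_mod_cast hn0
  set t := Real.logb 2 (n : ℝ) with ht
  have hnt : (2 : ℝ) ^ t = n := Real.rpow_logb zero_lt_two (by norm_num) hnR
  have hle : ∀ x : ℝ, (2 : ℝ) ^ x ≤ n → x ≤ t := fun x hx =>
    (Real.le_logb_iff_rpow_le one_lt_two hnR).2 hx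
  have ht1 : 1 ≤ t := hle 1 (by rw [Real.rpow_one]; exact_mod_cast hn2)
  have ht4 : 1 ≤ t ^ 4 := one_le_pow₀ ht1
  -- The range of `φ` forces `82 ^ 2 ≤ n`; this is why `a ≤ 2` needs no further threshold.
  have hn : (4096 : ℝ) ≤ n := by linarith
  have ht12 : 12 ≤ t := hle 12 (by norm_num; exact_mod_cast hn)
  have hat : 4 + a ≤ 2 * t := by
    split_ifs at hN with h2
    · linarith
    · have : a ≤ t := hle a (Nat.ceil_le.1 hN)
      linarith
  have hn8 : 8 ≤ Fintype.card (Fin n) := by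
    rw [Fintype.card_fin]
    have : (8 : ℝ) ≤ n := by linarith
    exact_mod_cast this
  have hsqrt : 82 * t ^ 2 ≤ Real.sqrt φ :=
    Real.le_sqrt_of_sq_le (by linarith [show (82 * t ^ 2) ^ 2 = 82 ^ 2 * t ^ 4 by ring])
  have hsqrt0 : 0 < Real.sqrt φ := by nlinarith
  have hm : 16 * (1 / 16 * φ) ≤ (Fintype.card (Fin n) : ℝ) := by
    rw [Fintype.card_fin]
    linarith
  have key := LocalFailover.one_sub_le_probNeeds d hn8 E hsqrt0 hm
  rw [Fintype.card_fin] at key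
  refine le_trans (sub_le_sub_left ?_ 1) key
  have hexp : 2 * Real.exp 6 ≤ n := by
    have h1 : Real.exp 6 = Real.exp 1 ^ 6 := by rw [← Real.exp_nat_mul]; norm_num
    have h2 : Real.exp 1 ^ 6 ≤ 3 ^ 6 :=
      pow_le_pow_left₀ (Real.exp_pos 1).le (by linarith [Real.exp_one_lt_d9]) 6
    rw [h1]
    linarith
  -- Exponent `4 + a`: 3 for the union bound, 1 to absorb `2 * exp 6`, and `a` for the failure
  -- probability.
  have hpow : (n : ℝ) ^ (4 + a) ≤ 2 ^ Real.sqrt φ := by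
    calc (n : ℝ) ^ (4 + a) = 2 ^ (t * (4 + a)) := by rw [Real.rpow_mul zero_le_two, hnt]
      _ ≤ 2 ^ Real.sqrt φ :=
        Real.rpow_le_rpow_of_exponent_le one_le_two (by nlinarith)
  have hna : (0 : ℝ) < (n : ℝ) ^ a := Real.rpow_pos_of_pos hnR a
  have hsplit : (n : ℝ) ^ (4 + a) = n ^ 3 * n * (n : ℝ) ^ a := by
    rw [Real.rpow_add hnR, ← pow_succ, ← Real.rpow_natCast]
    norm_num
  rw [mul_div_assoc', div_le_div_iff₀ (by positivity) hna, one_mul]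
  refine le_trans ?_ (hsplit ▸ hpow)
  gcongr
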